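/- Let $a,b,A_0,\xi,N,P_{\mathrm{avg}}>0$ and $k\in\{1,2\}$ ($k=1$ for heterodyne detection, $k=2$ for IM/DD). Let $\lambda=I_{\mathrm a}I_{\mathrm p}$ be the channel gain of the Gamma-Gamma turbulence channel with zero-boresight pointing error, where $I_{\mathrm a}$ and $I_{\mathrm p}$ are independent with probability densities $$f_{I_{\mathrm a}}(x)=\frac{2(ab)^{(a+b)/2}}{\Gamma(a)\Gamma(b)}\,x^{(a+b)/2-1}K_{a-b}\bigl(2\sqrt{abx}\bigr)\quad(x>0),\qquad f_{I_{\mathrm p}}(x)=\frac{\xi^2}{A_0^{\xi^2}}\,x^{\xi^2-1}\quad(0\le x\le A_0),$$ and $K_\nu$ is the modified Bessel function of the second kind. Let $$\overline C=\sup_{P}\ \frac1k\,\mathbb E\left[\log\left(1+\frac{\lambda P(\lambda)}{N}\right)\right]$$ be the ergodic capacity (in nats per symbol) with perfect channel state information at both ends, where $P\ge 0$ ranges over the measurable power-adaptation schemes with $\mathbb E[P(\lambda)]\le P_{\mathrm{avg}}$. All these expectations are finite. Write $\mathrm{SNR}_k=P_{\mathrm{avg}}/N$ and $x^+=\max(x,0)$.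 Then there is exactly one cutoff $\mu_k>0$ satisfying the average-power constraint $$\mathbb E\left[\left(\frac1{\mu_k}-\frac1\lambda\right)^{+}\right]=\mathrm{SNR}_k .$$ The supremum is a maximum, attained by the waterfilling scheme $P^*(\lambda)=N\left(\frac1{\mu_k}-\frac1\lambda\right)^+$, which is feasible, and $$\overline C=\frac1k\left[\log\frac{A_0}{ab}+\psi(a)+\psi(b)-\frac1{\xi^2}-\log\mu_k+\frac{\xi^2}{\Gamma(a)\Gamma(b)}\,G^{3,2}_{3,5}\left(\frac{ab}{A_0}\mu_k\,\middle|\,{1,\,1,\,\xi^2+1\atop \xi^2,\,a,\,b,\,0,\,0}\right)\right],$$ where $\psi$ is the digamma function and the Meijer function is given by the absolutely convergent Mellin–Barnes integral along any vertical line that separates the two families of poles (that is, $\operatorname{Re}s=c$ with $0<c<\min(\xi^2,a,b)$): $$G^{3,2}_{3,5}\left(z\,\middle|\,{1,\,1,\,\xi^2+1\atop \xi^2,\,a,\,b,\,0,\,0}\right)=\frac1{2\pi i}\int_{c-i\infty}^{c+i\infty}\frac{\Gamma(\xi^2-s)\Gamma(a-s)\Gamma(b-s)\,\Gamma(s)^2}{\Gamma(1+s)^2\,\Gamma(\xi^2+1-s)}\,z^s\,ds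 .$$ -/

import Mathlib

open MeasureTheory ProbabilityTheory Set

noncomputable section

/-! ### Special functions -/

/-- The modified Bessel function of the second kind of real order `ν`, for argument `x > 0`:
`K_ν(x) = ∫₀^∞ exp(-x cosh t) cosh(ν t) dt`. -/
def besselK (ν x : ℝ) : ℝ :=
  ∫ t in Ioi (0 : ℝ), Real.exp (-x * Real.cosh t) * Real.cosh (ν * t)

/-- The Mellin-Barnes kernel of the Meijer function `G^{m,n}_{p,q}` with upper parameters
`α₁, …, α_p` and lower parameters `β₁, …, β_q`:
`∏_{j ≤ m} Γ(β_j - s) ∏_{j ≤ n} Γ(1 - α_j + s) /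
  (∏_{j > m} Γ(1 - β_j + s) ∏_{j > n} Γ(α_j - s))`. -/
def meijerKernel (m n : ℕ) {p q : ℕ} (α : Fin p → ℂ) (β : Fin q → ℂ) (s : ℂ) : ℂ :=
  ((∏ j : Fin q, if j.val < m then Complex.Gamma (β j - s) else 1) *
      (∏ j : Fin p, if j.val < n then Complex.Gamma (1 - α j + s) else 1)) /
    ((∏ j : Fin q, if j.val < m then 1 else Complex.Gamma (1 - β j + s)) *
      (∏ j : Fin p, if j.val < n then 1 else Complex.Gamma (α j - s)))

/-- The vertical line `Re s = c` has all the poles of `Γ(β_j - s)`, `j ≤ m`, to its right, and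
all the poles of `Γ(1 - α_j + s)`, `j ≤ n`, to its left. -/
def MeijerSeparates (m n : ℕ) {p q : ℕ} (α : Fin p → ℂ) (β : Fin q → ℂ) (c : ℝ) : Prop :=
  (∀ j : Fin q, j.val < m → c < (β j).re) ∧ (∀ j : Fin p, j.val < n → (α j).re - 1 < c)

/-- The integrand `kernel(s) z ^ s` at the point `s = c + i t` of the line `Re s = c`. -/
def meijerIntegrand (m n : ℕ) {p q : ℕ} (α : Fin p → ℂ) (β : Fin q → ℂ) (z : ℂ) (c t : ℝ) : ℂ :=
  meijerKernel m n α β ((c : ℂ) + (t : ℂ) * Complex.I) * z ^ ((c : ℂ) + (t : ℂ) * Complex.I)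

/-- `w` is the value at `z` of the Meijer function `G^{m,n}_{p,q}(z | α ; β)`, i.e. of
`(1 / 2πi) ∫_L kernel(s) z ^ s ds`: some vertical line separates the two families of poles, and
along every such line `L` the integral converges absolutely and the value is `w`
(with `s = c + i t` and `ds = i dt`). -/
def HasMeijerG (m n : ℕ) {p q : ℕ} (α : Fin p → ℂ) (β : Fin q → ℂ) (z w : ℂ) : Prop :=
  (∃ c : ℝ, MeijerSeparates m n α β c) ∧
    ∀ c : ℝ, MeijerSeparates m n α β c →
      Integrable (fun t : ℝ => meijerIntegrand m n α β z c t) ∧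
        1 / (2 * (Real.pi : ℂ)) * ∫ t : ℝ, meijerIntegrand m n α β z c t = w

open Classical in
/-- The Meijer function `G^{m,n}_{p,q}(z | α ; β)`; the value is `0` where no `w` satisfies
`HasMeijerG`. -/
def meijerG (m n : ℕ) {p q : ℕ} (α : Fin p → ℂ) (β : Fin q → ℂ) (z : ℂ) : ℂ :=
  if h : ∃ w, HasMeijerG m n α β z w then h.choose else 0

/-! ### The fading channel -/

/-- The Gamma-Gamma probability density with parameters `a`, `b`. -/
def gammaGammaPDF (a b x : ℝ) : ℝ :=
  if 0 < x then
    2 * (a * b) ^ ((a + b) / 2) / (Real.Gamma a * Real.Gamma b) * x ^ ((a + b) / 2 - 1) *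
      besselK (a - b) (2 * Real.sqrt (a * b * x))
  else 0

/-- The Gamma-Gamma law of the turbulence-induced irradiance fluctuation. -/
def gammaGammaLaw (a b : ℝ) : Measure ℝ :=
  volume.withDensity fun x => ENNReal.ofReal (gammaGammaPDF a b x)

/-- The probability density of the zero-boresight pointing-error fluctuation, with parameters
`A₀` (fraction of power collected at zero displacement) and `ξ`. -/
def pointingErrorPDF (A₀ ξ x : ℝ) : ℝ :=
  if 0 ≤ x ∧ x ≤ A₀ then ξ ^ 2 / A₀ ^ (ξ ^ 2) * x ^ (ξ ^ 2 - 1) else 0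

/-- The law of the pointing-error fluctuation. -/
def pointingErrorLaw (A₀ ξ : ℝ) : Measure ℝ :=
  volume.withDensity fun x => ENNReal.ofReal (pointingErrorPDF A₀ ξ x)

/-! ### Power control and ergodic capacity -/

section Capacity

variable {Ω : Type*} [MeasurableSpace Ω]

/-- `P` is a feasible power-adaptation scheme for the channel gain `g`: the power `P (g)` is a
non-negative measurable function of the gain, with mean at most `Pavg`. -/
def IsFeasiblePolicy (Q : Measure Ω) (g : Ω → ℝ) (Pavg : ℝ) (P : ℝ → ℝ) : Prop :=
  Measurable P ∧ (∀ x, 0 ≤ P x) ∧ Integrable (fun ω => P (g ω)) Q ∧ ∫ ω, P (g ω) ∂Q ≤ Pavg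

/-- The average spectral efficiency `(1 / k) E[log (1 + g P(g) / N)]` of the scheme `P`. -/
def averageRate (Q : Measure Ω) (g : Ω → ℝ) (k : ℕ) (N : ℝ) (P : ℝ → ℝ) : ℝ :=
  1 / (k : ℝ) * ∫ ω, Real.log (1 + g ω * P (g ω) / N) ∂Q

/-- The average spectral efficiencies of all the feasible schemes. -/
def achievableRates (Q : Measure Ω) (g : Ω → ℝ) (k : ℕ) (N Pavg : ℝ) : Set ℝ :=
  {R | ∃ P : ℝ → ℝ, IsFeasiblePolicy Q g Pavg P ∧ R = averageRate Q g k N P}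

/-- The ergodic capacity under average-power constraint `Pavg` and noise power `N`. -/
def ergodicCapacity (Q : Measure Ω) (g : Ω → ℝ) (k : ℕ) (N Pavg : ℝ) : ℝ :=
  sSup (achievableRates Q g k N Pavg)

/-- The waterfilling scheme with cutoff `μ`: `P(x) = N (1 / μ - 1 / x)⁺`. -/
def waterfilling (N μ x : ℝ) : ℝ :=
  N * max (1 / μ - 1 / x) 0

/-- `μ > 0` is the waterfilling cutoff: `E[(1 / μ - 1 / g)⁺] = SNR`. -/
def IsWaterfillingCutoff (Q : Measure Ω) (g : Ω → ℝ) (SNR μ : ℝ) : Prop :=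
  0 < μ ∧ ∫ ω, max (1 / μ - 1 / g ω) 0 ∂Q = SNR

end Capacity

end

/-!
Waterfilling is optimal by Lagrangian duality: for each value `x > 0` of the gain, the power
`N (1 / μ - 1 / x)⁺` maximizes `log (1 + x p / N) - μ p / N` over `p ≥ 0`
(`log_one_add_le_waterfilling`), and integrating this bound gives `averageRate_le_waterfilling`.
The mean power is a continuous unbounded function `φ` of the water level `v = 1 / μ`, with
`φ (θ w) ≤ θ φ w` for `0 < θ ≤ 1` (`integral_max_sub_inv_le`), so that it takes each positive value
exactly once (`existsUnique_isWaterfillingCutoff`).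

The optimal rate is `E[log⁺ (g / μ)] / k = (E[log g] - log μ + E[log⁺ (μ / g)]) / k`, where `g` is
the gain. Both expectations come from the complex moments
`E[g ^ z] = (A₀ / (a b)) ^ z Γ(a + z) Γ(b + z) / (Γ(a) Γ(b)) · ξ² / (ξ² + z)`
(`complexMGF_log_gain`), treated as the moment-generating function of `log g`. They are computed
from the fact that the Gamma-Gamma law is the law of `X Y / (a b)` for independent Gamma variables
`X`, `Y` (`gammaGammaLaw_eq_map`). The derivative of the moments at `0` is `E[log g]`
(`integral_log_gain`). Mellin inversion gives `log⁺ y = (1 / 2πi) ∫ y ^ s / s² ds`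
(`integral_cpow_div_sq`); for `y = μ / g`, taking expectations under the integral turns the
integrand into the Mellin-Barnes integrand of the Meijer function, up to a constant
(`hasMeijerG_gain`).
Absolute convergence is thus free: the moments are bounded on vertical lines, and `1 / s²` is
integrable.
-/

/-! ### The Gamma-Gamma law as the law of a product of Gamma variables -/

theorem integrableOn_exp_neg_mul_cosh_mul_cosh (ν : ℝ) {x : ℝ} (hx : 0 < x) :
    IntegrableOn (fun t : ℝ => Real.exp (-x * Real.cosh t) * Real.cosh (ν * t)) (Ioi 0) := by
  -- The constant is `max_t ((|ν| + 1) t - x t² / 4)`: completing the square absorbs both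
  -- `cosh (ν t)` and the factor `exp t` of the comparison function into `exp (-x t² / 4)`.
  refine integrable_of_isBigO_exp_neg one_pos (by fun_prop)
    (Asymptotics.IsBigO.of_bound (Real.exp ((|ν| + 1) ^ 2 / x)) ?_)
  filter_upwards [Filter.eventually_ge_atTop (0 : ℝ)] with t ht
  rw [Real.norm_of_nonneg (by positivity), Real.norm_of_nonneg (by positivity), ← Real.exp_add]
  have h1 : Real.cosh (ν * t) ≤ Real.exp (|ν| * t) := by
    rw [← Real.cosh_abs, abs_mul, abs_of_nonneg ht, Real.cosh_eq]
    have : Real.exp (-(|ν| * t)) ≤ Real.exp (|ν| * t) :=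
      Real.exp_le_exp.2 (by nlinarith [mul_nonneg (abs_nonneg ν) ht])
    linarith
  have h2 : t ^ 2 / 4 ≤ Real.cosh t := by
    rw [Real.cosh_eq]
    nlinarith [Real.quadratic_le_exp_of_nonneg ht, Real.exp_pos (-t)]
  calc _ ≤ Real.exp (-x * Real.cosh t) * Real.exp (|ν| * t) := by gcongr
    _ = Real.exp (-x * Real.cosh t + |ν| * t) := (Real.exp_add _ _).symm
    _ ≤ _ := by
      refine Real.exp_le_exp.2 ?_
      have h3 : (|ν| + 1) * t ≤ (|ν| + 1) ^ 2 / x + x * (t ^ 2 / 4) := by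
        rw [← sub_nonneg]
        have : (|ν| + 1) ^ 2 / x + x * (t ^ 2 / 4) - (|ν| + 1) * t
            = ((|ν| + 1) - x * t / 2) ^ 2 / x := by field_simp; ring
        rw [this]; positivity
      nlinarith [mul_le_mul_of_nonneg_left h2 hx.le]

/-- The integral defining `K_ν`, unfolded from the half-line to the whole line. -/
theorem lintegral_exp_mul_exp_neg_mul_cosh (ν : ℝ) {x : ℝ} (hx : 0 < x) :
    ∫⁻ t : ℝ, ENNReal.ofReal (Real.exp (ν * t) * Real.exp (-x * Real.cosh t))
      = ENNReal.ofReal (2 * besselK ν x) := by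
  rw [besselK, ← integral_const_mul, ofReal_integral_eq_lintegral_ofReal
    ((integrableOn_exp_neg_mul_cosh_mul_cosh ν hx).const_mul 2)
    (ae_of_all _ fun t => by positivity), ← lintegral_add_compl _ (measurableSet_Ioi (a := (0:ℝ))),
    compl_Ioi, setLIntegral_congr Iio_ae_eq_Iic.symm,
    show (Iio (0 : ℝ)) = (fun t : ℝ => -t) '' Ioi 0 by simp,
    lintegral_image_eq_lintegral_abs_deriv_mul (f' := fun _ => -1) measurableSet_Ioi
      (fun t _ => (hasDerivAt_neg t).hasDerivWithinAt) neg_injective.injOn,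
    ← lintegral_add_left (by fun_prop)]
  refine lintegral_congr fun t => ?_
  rw [abs_neg, abs_one, ENNReal.ofReal_one, one_mul,
    ← ENNReal.ofReal_add (by positivity) (by positivity), Real.cosh_neg, Real.cosh_eq (ν * t)]
  congr 1
  rw [mul_neg]
  ring

theorem gammaMeasure_eq_withDensity_restrict (a : ℝ) :
    gammaMeasure a 1 = (volume.restrict (Ioi 0)).withDensity
      (fun x => ENNReal.ofReal (x ^ (a - 1) * Real.exp (-x) / Real.Gamma a)) := by
  rw [gammaMeasure, ← withDensity_indicator measurableSet_Ioi]
  refine withDensity_congr_ae ?_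
  filter_upwards [Measure.ae_ne volume (0 : ℝ)] with x hx
  rcases lt_or_gt_of_ne hx with h | h
  · rw [gammaPDF_of_neg h, indicator_of_notMem (by simpa using h.le)]
  · rw [gammaPDF_of_nonneg h.le, indicator_of_mem (by simpa using h)]
    congr 1
    simp
    ring

/-- The density of `X Y / (a b)` for independent Gamma variables `X`, `Y` of shapes `a`, `b`, as a
convolution integral. The substitution `x = √(a b z) exp t` turns it into the integral that
defines `K_{a-b}`. -/
theorem lintegral_gamma_mul_gamma {a b z : ℝ} (ha : 0 < a) (hb : 0 < b) (hz : 0 < z) :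
    ∫⁻ x in Ioi (0 : ℝ), ENNReal.ofReal (x ^ (a - 1) * Real.exp (-x) / Real.Gamma a) *
      (ENNReal.ofReal (a * b / x) * ENNReal.ofReal ((a * b / x * z) ^ (b - 1) *
        Real.exp (-(a * b / x * z)) / Real.Gamma b))
      = ENNReal.ofReal (gammaGammaPDF a b z) := by
  have hw : 0 < a * b * z := by positivity
  set r := Real.sqrt (a * b * z) with hr
  have hr0 : 0 < r := Real.sqrt_pos.2 hw
  have hrr : a * b * z = r * r := (Real.mul_self_sqrt hw.le).symm
  have hΓa := Real.Gamma_pos_of_pos ha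
  have hΓb := Real.Gamma_pos_of_pos hb
  have himg : (fun t : ℝ => r * Real.exp t) '' univ = Ioi 0 := by
    ext x
    simp only [image_univ, mem_range, mem_Ioi]
    refine ⟨fun ⟨t, h⟩ => h ▸ by positivity, fun h => ⟨Real.log (x / r), ?_⟩⟩
    rw [Real.exp_log (by positivity)]
    field_simp
  rw [← himg, lintegral_image_eq_lintegral_abs_deriv_mul (f' := fun t => r * Real.exp t)
    MeasurableSet.univ (fun t _ => ((Real.hasDerivAt_exp t).const_mul r).hasDerivWithinAt)
    (fun t _ u _ h => by simpa [hr0.ne'] using h), setLIntegral_univ]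
  have key : ∀ t : ℝ, ENNReal.ofReal |r * Real.exp t| *
      (ENNReal.ofReal ((r * Real.exp t) ^ (a - 1) * Real.exp (-(r * Real.exp t)) / Real.Gamma a) *
      (ENNReal.ofReal (a * b / (r * Real.exp t)) *
        ENNReal.ofReal ((a * b / (r * Real.exp t) * z) ^ (b - 1) *
        Real.exp (-(a * b / (r * Real.exp t) * z)) / Real.Gamma b)))
      = ENNReal.ofReal (a * b * r ^ (a + b - 2) / (Real.Gamma a * Real.Gamma b)) *
        ENNReal.ofReal (Real.exp ((a - b) * t) * Real.exp (-(2 * r) * Real.cosh t)) := by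
    intro t
    have h1 : a * b / (r * Real.exp t) * z = r * Real.exp (-t) := by
      rw [Real.exp_neg]
      field_simp
      linarith
    rw [h1, abs_of_pos (by positivity), ← ENNReal.ofReal_mul (by positivity),
      ← ENNReal.ofReal_mul (by positivity), ← ENNReal.ofReal_mul (by positivity),
      ← ENNReal.ofReal_mul (by positivity)]
    congr 1
    rw [Real.mul_rpow hr0.le (Real.exp_pos _).le, Real.mul_rpow hr0.le (Real.exp_pos _).le,
      ← Real.exp_mul, ← Real.exp_mul, show a + b - 2 = (a - 1) + (b - 1) by ring,
      Real.rpow_add hr0, Real.cosh_eq,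
      show (a - b) * t = t * (a - 1) + -t * (b - 1) by ring, Real.exp_add (t * (a - 1)),
      show -(2 * r) * ((Real.exp t + Real.exp (-t)) / 2)
        = -(r * Real.exp t) + -(r * Real.exp (-t)) by ring, Real.exp_add (-(r * Real.exp t))]
    field_simp
  simp_rw [key]
  rw [lintegral_const_mul _ (by fun_prop), lintegral_exp_mul_exp_neg_mul_cosh _ (by positivity),
    ← ENNReal.ofReal_mul (by positivity), gammaGammaPDF, if_pos hz]
  congr 1
  have h2 : a * b * r ^ (a + b - 2) = (a * b) ^ ((a + b) / 2) * z ^ ((a + b) / 2 - 1) := by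
    rw [hr, Real.sqrt_eq_rpow, ← Real.rpow_mul hw.le,
      show 1 / 2 * (a + b - 2) = (a + b) / 2 - 1 by ring,
      Real.mul_rpow (by positivity) hz.le, Real.rpow_sub_one (by positivity : a * b ≠ 0)]
    field_simp
  rw [h2]
  ring

/-- The Gamma-Gamma law is the law of `X Y / (a b)`, for independent Gamma variables `X` and `Y`
of shapes `a` and `b` and rate `1`. -/
theorem gammaGammaLaw_eq_map {a b : ℝ} (ha : 0 < a) (hb : 0 < b) :
    gammaGammaLaw a b = ((gammaMeasure a 1).prod (gammaMeasure b 1)).map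
      (fun p => p.1 * p.2 / (a * b)) := by
  have : IsProbabilityMeasure (gammaMeasure a 1) := isProbabilityMeasure_gammaMeasure ha one_pos
  have : IsProbabilityMeasure (gammaMeasure b 1) := isProbabilityMeasure_gammaMeasure hb one_pos
  obtain ⟨F, hF⟩ : ∃ F : ℝ → ℝ → ENNReal, F = fun z x =>
      ENNReal.ofReal (x ^ (a - 1) * Real.exp (-x) / Real.Gamma a) *
      (ENNReal.ofReal (a * b / x) * ENNReal.ofReal ((a * b / x * z) ^ (b - 1) *
        Real.exp (-(a * b / x * z)) / Real.Gamma b)) := ⟨_, rfl⟩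
  have hFm : Measurable (Function.uncurry F) := by
    rw [hF]
    simp only [Function.uncurry_def]
    fun_prop
  have hGG : gammaGammaLaw a b =
      (volume.restrict (Ioi 0)).withDensity (fun z => ∫⁻ x in Ioi (0 : ℝ), F z x) := by
    rw [gammaGammaLaw, ← withDensity_indicator measurableSet_Ioi]
    congr 1
    ext z
    by_cases hz : 0 < z
    · rw [indicator_of_mem (by simpa using hz), hF, lintegral_gamma_mul_gamma ha hb hz]
    · rw [indicator_of_notMem (by simpa using hz), gammaGammaPDF, if_neg hz, ENNReal.ofReal_zero]
  refine Measure.ext_of_lintegral _ fun f hf => ?_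
  rw [lintegral_map hf (by fun_prop), lintegral_prod _ (by fun_prop), hGG,
    lintegral_withDensity_eq_lintegral_mul _ hFm.lintegral_prod_right hf,
    gammaMeasure_eq_withDensity_restrict, gammaMeasure_eq_withDensity_restrict,
    lintegral_withDensity_eq_lintegral_mul _ (by fun_prop)
      (Measurable.lintegral_prod_right (by fun_prop))]
  simp only [Pi.mul_apply]
  -- Tonelli: integrate over `z` first, for fixed `x`; then `y = a b z / x` is the second variable.
  have hpull : ∀ z, (∫⁻ x in Ioi (0 : ℝ), F z x) * f z = ∫⁻ x in Ioi (0 : ℝ), F z x * f z :=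
    fun z => (lintegral_mul_const (f z) (hFm.comp (measurable_const.prodMk measurable_id))).symm
  rw [lintegral_congr hpull,
    lintegral_lintegral_swap (hFm.mul (hf.comp measurable_fst)).aemeasurable, hF]
  refine setLIntegral_congr_fun measurableSet_Ioi fun x (hx : 0 < x) => ?_
  simp only
  rw [lintegral_withDensity_eq_lintegral_mul _ (by fun_prop) (by fun_prop)]
  have hc : 0 < a * b / x := by positivity
  have himg : (fun z : ℝ => a * b / x * z) '' Ioi 0 = Ioi 0 := by
    rw [image_mul_left_Ioi hc, mul_zero]
  conv_rhs => rw [← himg]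
  rw [lintegral_image_eq_lintegral_abs_deriv_mul (f' := fun _ => a * b / x) measurableSet_Ioi
    (fun z _ => by simpa using ((hasDerivAt_id z).const_mul (a * b / x)).hasDerivWithinAt)
    (mul_right_injective₀ hc.ne').injOn, ← lintegral_const_mul _ (by fun_prop)]
  refine lintegral_congr fun z => ?_
  simp only [Pi.mul_apply, abs_of_pos hc]
  rw [show x * (a * b / x * z) / (a * b) = z by field_simp]
  ring

/-! ### Moments of the channel gain -/

section Moments

variable {Ω : Type*} [MeasurableSpace Ω] {Q : Measure Ω}

theorem cexp_mul_log {x : ℝ} (hx : 0 < x) (z : ℂ) : Complex.exp (z * Real.log x) = (x : ℂ) ^ z := by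
  rw [Complex.cpow_def_of_ne_zero (by exact_mod_cast hx.ne'), Complex.ofReal_log hx.le, mul_comm]

theorem hasLaw_complexMGF_log {X : Ω → ℝ} {ν : Measure ℝ} (hX : HasLaw X ν Q) (z : ℂ) :
    complexMGF (fun ω => Real.log (X ω)) Q z = complexMGF Real.log ν z := by
  rw [← hX.map_eq]
  refine (integral_map (f := fun x => Complex.exp (z * Real.log x)) hX.aemeasurable
    (Measurable.aestronglyMeasurable (by fun_prop))).symm

theorem hasLaw_mem_integrableExpSet_log {X : Ω → ℝ} {ν : Measure ℝ} (hX : HasLaw X ν Q) (t : ℝ) :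
    t ∈ integrableExpSet (fun ω => Real.log (X ω)) Q ↔ t ∈ integrableExpSet Real.log ν := by
  rw [← hX.map_eq]
  exact (integrable_map_measure (g := fun x => Real.exp (t * Real.log x))
    (Measurable.aestronglyMeasurable (by fun_prop)) hX.aemeasurable).symm

theorem log_mul_ae_eq {X Y : Ω → ℝ} (hX0 : ∀ᵐ ω ∂Q, 0 < X ω) (hY0 : ∀ᵐ ω ∂Q, 0 < Y ω) :
    (fun ω => Real.log (X ω * Y ω)) =ᵐ[Q] fun ω => Real.log (X ω) + Real.log (Y ω) := by
  filter_upwards [hX0, hY0] with ω h1 h2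
  exact Real.log_mul h1.ne' h2.ne'

theorem complexMGF_log_mul {X Y : Ω → ℝ} (hXY : IndepFun X Y Q) (hX : AEMeasurable X Q)
    (hY : AEMeasurable Y Q) (hX0 : ∀ᵐ ω ∂Q, 0 < X ω) (hY0 : ∀ᵐ ω ∂Q, 0 < Y ω) (z : ℂ) :
    complexMGF (fun ω => Real.log (X ω * Y ω)) Q z =
      complexMGF (fun ω => Real.log (X ω)) Q z * complexMGF (fun ω => Real.log (Y ω)) Q z := by
  simp only [complexMGF]
  rw [← hXY.integral_fun_comp_mul_comp (f := fun x : ℝ => Complex.exp (z * Real.log x))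
    (g := fun x : ℝ => Complex.exp (z * Real.log x)) hX hY
    (AEMeasurable.aestronglyMeasurable (by fun_prop))
    (AEMeasurable.aestronglyMeasurable (by fun_prop))]
  refine integral_congr_ae ?_
  filter_upwards [log_mul_ae_eq hX0 hY0] with ω h
  rw [h, ← Complex.exp_add]
  push_cast
  ring_nf

theorem mem_integrableExpSet_log_mul {X Y : Ω → ℝ} (hXY : IndepFun X Y Q)
    (hX0 : ∀ᵐ ω ∂Q, 0 < X ω) (hY0 : ∀ᵐ ω ∂Q, 0 < Y ω) {t : ℝ}
    (hXt : t ∈ integrableExpSet (fun ω => Real.log (X ω)) Q)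
    (hYt : t ∈ integrableExpSet (fun ω => Real.log (Y ω)) Q) :
    t ∈ integrableExpSet (fun ω => Real.log (X ω * Y ω)) Q := by
  have h := (hXY.comp Real.measurable_log Real.measurable_log).integrable_exp_mul_add hXt hYt
  refine h.congr ?_
  filter_upwards [log_mul_ae_eq hX0 hY0] with ω h
  simp only [h, Pi.add_apply, Function.comp_apply]

end Moments

section Density

variable {S : Set ℝ} {h : ℝ → ℝ}

theorem ae_pos_withDensity_restrict (hS : MeasurableSet S) (hS0 : S ⊆ Ioi 0) :
    ∀ᵐ x ∂(volume.restrict S).withDensity (fun x => ENNReal.ofReal (h x)), 0 < x :=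
  (withDensity_absolutelyContinuous _ _).ae_le
    ((ae_restrict_iff' hS).2 (ae_of_all _ fun _ hx => hS0 hx))

theorem integrable_withDensity_restrict_iff (hS : MeasurableSet S) (hm : Measurable h)
    (h0 : ∀ x ∈ S, 0 ≤ h x) {f : ℝ → ℂ} :
    Integrable f ((volume.restrict S).withDensity fun x => ENNReal.ofReal (h x)) ↔
      IntegrableOn (fun x => (h x : ℂ) * f x) S := by
  rw [integrable_withDensity_iff_integrable_smul' (by fun_prop) (by simp)]
  refine integrable_congr ?_
  filter_upwards [ae_restrict_mem hS] with x hx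
  rw [ENNReal.toReal_ofReal (h0 x hx), Complex.real_smul]

theorem integral_withDensity_restrict (hS : MeasurableSet S) (hm : Measurable h)
    (h0 : ∀ x ∈ S, 0 ≤ h x) (f : ℝ → ℂ) :
    ∫ x, f x ∂((volume.restrict S).withDensity fun x => ENNReal.ofReal (h x)) =
      ∫ x in S, (h x : ℂ) * f x := by
  rw [integral_withDensity_eq_integral_toReal_smul (by fun_prop) (by simp)]
  refine integral_congr_ae ?_
  filter_upwards [ae_restrict_mem hS] with x hx
  rw [ENNReal.toReal_ofReal (h0 x hx), Complex.real_smul]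

end Density

theorem mem_integrableExpSet_iff_cexp {ν : Measure ℝ} (t : ℝ) :
    t ∈ integrableExpSet Real.log ν ↔
      Integrable (fun x : ℝ => Complex.exp ((t : ℂ) * Real.log x)) ν := by
  rw [← integrable_norm_iff (AEMeasurable.aestronglyMeasurable (by fun_prop))]
  simp only [Complex.norm_exp]
  simp [integrableExpSet]

/-- The integrand of the moment `E[X ^ z]` of a Gamma variable, as that of Euler's integral for
`Γ(a + z)`. -/
theorem gammaMeasure_density_mul_cexp (a : ℝ) (z : ℂ) {x : ℝ} (hx : 0 < x) :
    ((x ^ (a - 1) * Real.exp (-x) / Real.Gamma a : ℝ) : ℂ) * Complex.exp (z * Real.log x) =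
      (Real.Gamma a : ℂ)⁻¹ * ((Real.exp (-x) : ℂ) * (x : ℂ) ^ ((a : ℂ) + z - 1)) := by
  rw [cexp_mul_log hx, show (a : ℂ) + z - 1 = ((a - 1 : ℝ) : ℂ) + z by push_cast; ring,
    Complex.cpow_add _ _ (by exact_mod_cast hx.ne'), ← Complex.ofReal_cpow hx.le]
  push_cast
  ring

theorem mem_integrableExpSet_log_gammaMeasure {a t : ℝ} (ha : 0 < a) (ht : -a < t) :
    t ∈ integrableExpSet Real.log (gammaMeasure a 1) := by
  have hΓ := Real.Gamma_pos_of_pos ha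
  rw [mem_integrableExpSet_iff_cexp, gammaMeasure_eq_withDensity_restrict,
    integrable_withDensity_restrict_iff measurableSet_Ioi (by fun_prop)
      (fun x (hx : 0 < x) => by positivity),
    integrableOn_congr_fun (fun x (hx : x ∈ Ioi 0) => gammaMeasure_density_mul_cexp a t hx)
      measurableSet_Ioi]
  exact (Complex.GammaIntegral_convergent (s := (a : ℂ) + t) (by simp; linarith)).const_mul _

theorem complexMGF_log_gammaMeasure {a : ℝ} (ha : 0 < a) {z : ℂ} (hz : -a < z.re) :
    complexMGF Real.log (gammaMeasure a 1) z = Complex.Gamma (a + z) / Real.Gamma a := by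
  have hΓ := Real.Gamma_pos_of_pos ha
  rw [complexMGF, gammaMeasure_eq_withDensity_restrict,
    integral_withDensity_restrict measurableSet_Ioi (by fun_prop)
      (fun x (hx : 0 < x) => by positivity),
    setIntegral_congr_fun measurableSet_Ioi
      (fun x hx => gammaMeasure_density_mul_cexp a z hx), integral_const_mul,
    Complex.Gamma_eq_integral (s := (a : ℂ) + z) (by simp; linarith), Complex.GammaIntegral]
  field_simp

theorem ae_pos_gammaMeasure (a : ℝ) : ∀ᵐ x ∂gammaMeasure a 1, 0 < x := by
  rw [gammaMeasure_eq_withDensity_restrict]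
  exact ae_pos_withDensity_restrict measurableSet_Ioi subset_rfl

theorem ae_pos_gammaGammaLaw (a b : ℝ) : ∀ᵐ x ∂gammaGammaLaw a b, 0 < x := by
  rw [gammaGammaLaw, show (fun x => ENNReal.ofReal (gammaGammaPDF a b x)) =
    (Ioi 0).indicator (fun x => ENNReal.ofReal (gammaGammaPDF a b x)) by
      ext x
      by_cases hx : 0 < x
      · rw [indicator_of_mem (by simpa using hx)]
      · rw [indicator_of_notMem (by simpa using hx), gammaGammaPDF, if_neg hx,
          ENNReal.ofReal_zero], withDensity_indicator measurableSet_Ioi]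
  exact ae_pos_withDensity_restrict measurableSet_Ioi subset_rfl

section GammaGamma

variable {a b : ℝ}

theorem hasLaw_mul_div_gammaGammaLaw (ha : 0 < a) (hb : 0 < b) :
    HasLaw (fun p : ℝ × ℝ => p.1 * p.2 / (a * b)) (gammaGammaLaw a b)
      ((gammaMeasure a 1).prod (gammaMeasure b 1)) where
  aemeasurable := by fun_prop
  map_eq := (gammaGammaLaw_eq_map ha hb).symm

theorem ae_pos_prod_gammaMeasure (ha : 0 < a) (hb : 0 < b) :
    (∀ᵐ p ∂(gammaMeasure a 1).prod (gammaMeasure b 1), 0 < p.1) ∧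
      ∀ᵐ p ∂(gammaMeasure a 1).prod (gammaMeasure b 1), 0 < p.2 := by
  have := isProbabilityMeasure_gammaMeasure ha one_pos
  have := isProbabilityMeasure_gammaMeasure hb one_pos
  exact ⟨Measure.quasiMeasurePreserving_fst.ae (ae_pos_gammaMeasure a),
    Measure.quasiMeasurePreserving_snd.ae (ae_pos_gammaMeasure b)⟩

theorem log_mul_div_ae_eq (ha : 0 < a) (hb : 0 < b) :
    (fun p : ℝ × ℝ => Real.log (p.1 * p.2 / (a * b)))
      =ᵐ[(gammaMeasure a 1).prod (gammaMeasure b 1)]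
    fun p => Real.log (p.1 * p.2) - Real.log (a * b) := by
  filter_upwards [(ae_pos_prod_gammaMeasure ha hb).1, (ae_pos_prod_gammaMeasure ha hb).2]
    with p h1 h2
  exact Real.log_div (by positivity) (by positivity)

theorem mem_integrableExpSet_log_gammaGammaLaw (ha : 0 < a) (hb : 0 < b) {t : ℝ} (hta : -a < t)
    (htb : -b < t) : t ∈ integrableExpSet Real.log (gammaGammaLaw a b) := by
  have := isProbabilityMeasure_gammaMeasure ha one_pos
  have := isProbabilityMeasure_gammaMeasure hb one_pos
  rw [← hasLaw_mem_integrableExpSet_log (hasLaw_mul_div_gammaGammaLaw ha hb)]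
  have h := mem_integrableExpSet_log_mul (t := t)
    (indepFun_prod (μ := gammaMeasure a 1) (ν := gammaMeasure b 1) measurable_id measurable_id)
    (ae_pos_prod_gammaMeasure ha hb).1 (ae_pos_prod_gammaMeasure ha hb).2
    ((hasLaw_mem_integrableExpSet_log measurePreserving_fst.hasLaw t).2
      (mem_integrableExpSet_log_gammaMeasure ha hta))
    ((hasLaw_mem_integrableExpSet_log measurePreserving_snd.hasLaw t).2
      (mem_integrableExpSet_log_gammaMeasure hb htb))
  refine (Integrable.mul_const h (Real.exp (-(t * Real.log (a * b))))).congr ?_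
  filter_upwards [log_mul_div_ae_eq ha hb] with p hp
  rw [hp, ← Real.exp_add]
  simp only [id]
  ring_nf

theorem complexMGF_log_gammaGammaLaw (ha : 0 < a) (hb : 0 < b) {z : ℂ} (hza : -a < z.re)
    (hzb : -b < z.re) :
    complexMGF Real.log (gammaGammaLaw a b) z = Complex.exp (-(z * Real.log (a * b))) *
      (Complex.Gamma (a + z) / Real.Gamma a * (Complex.Gamma (b + z) / Real.Gamma b)) := by
  have := isProbabilityMeasure_gammaMeasure ha one_pos
  have := isProbabilityMeasure_gammaMeasure hb one_pos
  rw [← hasLaw_complexMGF_log (hasLaw_mul_div_gammaGammaLaw ha hb),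
    ← complexMGF_log_gammaMeasure ha hza, ← complexMGF_log_gammaMeasure hb hzb,
    ← hasLaw_complexMGF_log
      (measurePreserving_fst (μ := gammaMeasure a 1) (ν := gammaMeasure b 1)).hasLaw,
    ← hasLaw_complexMGF_log
      (measurePreserving_snd (μ := gammaMeasure a 1) (ν := gammaMeasure b 1)).hasLaw,
    ← complexMGF_log_mul
      (X := fun p : ℝ × ℝ => p.1) (Y := fun p : ℝ × ℝ => p.2)
      (indepFun_prod (μ := gammaMeasure a 1) (ν := gammaMeasure b 1) measurable_id measurable_id)
      measurable_fst.aemeasurable measurable_snd.aemeasurable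
      (ae_pos_prod_gammaMeasure ha hb).1 (ae_pos_prod_gammaMeasure ha hb).2]
  simp only [complexMGF]
  rw [← integral_const_mul]
  refine integral_congr_ae ?_
  filter_upwards [log_mul_div_ae_eq ha hb] with p hp
  rw [hp, ← Complex.exp_add]
  push_cast
  ring_nf

end GammaGamma

section PointingError

variable {A₀ ξ : ℝ}

theorem re_ofReal_sq (ξ : ℝ) : ((ξ : ℂ) ^ 2).re = ξ ^ 2 := by
  rw [← Complex.ofReal_pow, Complex.ofReal_re]

theorem pointingErrorLaw_eq_withDensity_restrict (A₀ ξ : ℝ) :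
    pointingErrorLaw A₀ ξ = (volume.restrict (Ioc 0 A₀)).withDensity
      (fun x => ENNReal.ofReal (ξ ^ 2 / A₀ ^ (ξ ^ 2) * x ^ (ξ ^ 2 - 1))) := by
  rw [pointingErrorLaw, ← withDensity_indicator measurableSet_Ioc]
  refine withDensity_congr_ae ?_
  filter_upwards [Measure.ae_ne volume (0 : ℝ)] with x hx
  by_cases h : x ∈ Ioc 0 A₀
  · rw [indicator_of_mem h, pointingErrorPDF, if_pos ⟨h.1.le, h.2⟩]
  · rw [indicator_of_notMem h, pointingErrorPDF, if_neg, ENNReal.ofReal_zero]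
    exact fun h' => h ⟨h'.1.lt_of_ne' hx, h'.2⟩

theorem ae_pos_pointingErrorLaw (A₀ ξ : ℝ) : ∀ᵐ x ∂pointingErrorLaw A₀ ξ, 0 < x := by
  rw [pointingErrorLaw_eq_withDensity_restrict]
  exact ae_pos_withDensity_restrict measurableSet_Ioc fun x hx => hx.1

theorem pointingError_density_mul_cexp (z : ℂ) {x : ℝ} (hx : 0 < x) :
    ((ξ ^ 2 / A₀ ^ (ξ ^ 2) * x ^ (ξ ^ 2 - 1) : ℝ) : ℂ) * Complex.exp (z * Real.log x) =
      ((ξ ^ 2 / A₀ ^ (ξ ^ 2) : ℝ) : ℂ) * (x : ℂ) ^ ((ξ : ℂ) ^ 2 - 1 + z) := by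
  rw [cexp_mul_log hx, show (ξ : ℂ) ^ 2 - 1 + z = ((ξ ^ 2 - 1 : ℝ) : ℂ) + z by push_cast; ring,
    Complex.cpow_add _ _ (by exact_mod_cast hx.ne'), ← Complex.ofReal_cpow hx.le]
  push_cast
  ring

theorem mem_integrableExpSet_log_pointingErrorLaw (hA₀ : 0 < A₀) {t : ℝ} (ht : -ξ ^ 2 < t) :
    t ∈ integrableExpSet Real.log (pointingErrorLaw A₀ ξ) := by
  rw [mem_integrableExpSet_iff_cexp, pointingErrorLaw_eq_withDensity_restrict,
    integrable_withDensity_restrict_iff measurableSet_Ioc (by fun_prop)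
      (fun x hx => by have := hx.1; positivity),
    integrableOn_congr_fun (fun x (hx : x ∈ Ioc 0 A₀) => pointingError_density_mul_cexp t hx.1)
      measurableSet_Ioc,
    ← intervalIntegrable_iff_integrableOn_Ioc_of_le hA₀.le]
  refine (intervalIntegral.intervalIntegrable_cpow' ?_).const_mul _
  simp [re_ofReal_sq]
  linarith

theorem complexMGF_log_pointingErrorLaw (hA₀ : 0 < A₀) {z : ℂ} (hz : -ξ ^ 2 < z.re) :
    complexMGF Real.log (pointingErrorLaw A₀ ξ) z =
      Complex.exp (z * Real.log A₀) * ((ξ : ℂ) ^ 2 / ((ξ : ℂ) ^ 2 + z)) := by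
  have hre : 0 < ((ξ : ℂ) ^ 2 + z).re := by
    simp [re_ofReal_sq]
    linarith
  have hne : (ξ : ℂ) ^ 2 + z ≠ 0 := fun h => by simp [h] at hre
  rw [complexMGF, pointingErrorLaw_eq_withDensity_restrict,
    integral_withDensity_restrict measurableSet_Ioc (by fun_prop)
      (fun x hx => by have := hx.1; positivity),
    setIntegral_congr_fun measurableSet_Ioc
      (fun x (hx : x ∈ Ioc 0 A₀) => pointingError_density_mul_cexp z hx.1), integral_const_mul,
    ← intervalIntegral.integral_of_le hA₀.le, integral_cpow (Or.inl (by
      rw [show (ξ : ℂ) ^ 2 - 1 + z = ((ξ : ℂ) ^ 2 + z) - 1 by ring, Complex.sub_re,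
        Complex.one_re]
      linarith)),
    show (ξ : ℂ) ^ 2 - 1 + z + 1 = (ξ : ℂ) ^ 2 + z by ring, Complex.ofReal_zero,
    Complex.zero_cpow hne, sub_zero, cexp_mul_log hA₀,
    Complex.cpow_add _ _ (by exact_mod_cast hA₀.ne')]
  have hp : (A₀ : ℂ) ^ ((ξ : ℂ) ^ 2) = ((A₀ ^ (ξ ^ 2) : ℝ) : ℂ) := by
    rw [Complex.ofReal_cpow hA₀.le]
    push_cast
    rfl
  have hp0 : ((A₀ ^ (ξ ^ 2) : ℝ) : ℂ) ≠ 0 := by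
    exact_mod_cast (Real.rpow_pos_of_pos hA₀ _).ne'
  rw [hp]
  push_cast at hp0 ⊢
  field_simp

end PointingError

section Gain

variable {Ω : Type*} [MeasurableSpace Ω] {Q : Measure Ω} {Ia Ip : Ω → ℝ} {a b A₀ ξ : ℝ}

theorem ae_pos_gain (hIa : HasLaw Ia (gammaGammaLaw a b) Q)
    (hIp : HasLaw Ip (pointingErrorLaw A₀ ξ) Q) :
    (∀ᵐ ω ∂Q, 0 < Ia ω) ∧ ∀ᵐ ω ∂Q, 0 < Ip ω := by
  constructor
  · have := ae_pos_gammaGammaLaw a b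
    rw [← hIa.map_eq] at this
    exact ae_of_ae_map hIa.aemeasurable this
  · have := ae_pos_pointingErrorLaw A₀ ξ
    rw [← hIp.map_eq] at this
    exact ae_of_ae_map hIp.aemeasurable this

theorem mem_integrableExpSet_log_gain (ha : 0 < a) (hb : 0 < b) (hA₀ : 0 < A₀)
    (hIa : HasLaw Ia (gammaGammaLaw a b) Q) (hIp : HasLaw Ip (pointingErrorLaw A₀ ξ) Q)
    (hindep : IndepFun Ia Ip Q) {t : ℝ} (hta : -a < t) (htb : -b < t) (htξ : -ξ ^ 2 < t) :
    t ∈ integrableExpSet (fun ω => Real.log (Ia ω * Ip ω)) Q :=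
  mem_integrableExpSet_log_mul hindep (ae_pos_gain hIa hIp).1 (ae_pos_gain hIa hIp).2
    ((hasLaw_mem_integrableExpSet_log hIa t).2
      (mem_integrableExpSet_log_gammaGammaLaw ha hb hta htb))
    ((hasLaw_mem_integrableExpSet_log hIp t).2 (mem_integrableExpSet_log_pointingErrorLaw hA₀ htξ))

/-- The complex moments `E[λ ^ z]` of the channel gain `λ`, as the moment-generating function of
`log λ`. -/
theorem complexMGF_log_gain (ha : 0 < a) (hb : 0 < b) (hA₀ : 0 < A₀)
    (hIa : HasLaw Ia (gammaGammaLaw a b) Q) (hIp : HasLaw Ip (pointingErrorLaw A₀ ξ) Q)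
    (hindep : IndepFun Ia Ip Q) {z : ℂ} (hza : -a < z.re) (hzb : -b < z.re)
    (hzξ : -ξ ^ 2 < z.re) :
    complexMGF (fun ω => Real.log (Ia ω * Ip ω)) Q z =
      Complex.exp (z * Real.log (A₀ / (a * b))) *
        (Complex.Gamma (a + z) / Real.Gamma a * (Complex.Gamma (b + z) / Real.Gamma b)) *
        ((ξ : ℂ) ^ 2 / ((ξ : ℂ) ^ 2 + z)) := by
  rw [complexMGF_log_mul hindep hIa.aemeasurable hIp.aemeasurable (ae_pos_gain hIa hIp).1
    (ae_pos_gain hIa hIp).2, hasLaw_complexMGF_log hIa, hasLaw_complexMGF_log hIp,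
    complexMGF_log_gammaGammaLaw ha hb hza hzb, complexMGF_log_pointingErrorLaw hA₀ hzξ,
    Real.log_div hA₀.ne' (by positivity), Complex.ofReal_sub, mul_sub, sub_eq_add_neg,
    Complex.exp_add]
  ring

end Gain

/-! ### Mellin-Barnes representation of a truncated logarithm -/

/-- On `(0, 1]`, `log⁺ (1 / x) = -log x`, so this is minus the derivative of the Mellin transform
`1 / s` of the indicator function of `(0, 1]`. -/
theorem hasMellin_posLog_inv {s : ℂ} (hs : 0 < s.re) :
    HasMellin (fun x : ℝ => (Real.posLog x⁻¹ : ℂ)) s (1 / s ^ 2) := by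
  have hloc : LocallyIntegrableOn (indicator (Ioc 0 1) (fun _ => 1 : ℝ → ℂ)) (Ioi 0) := by
    refine LocallyIntegrable.locallyIntegrableOn ?_ _
    exact ((integrable_indicator_iff measurableSet_Ioc).2 (by simp)).locallyIntegrable
  have hD := mellin_hasDerivAt_of_isBigO_rpow (f := indicator (Ioc 0 1) (fun _ => 1 : ℝ → ℂ))
    (s := s) (a := s.re + 1) (b := 0) hloc
    (by
      refine Asymptotics.IsBigO.of_bound 0 ?_
      filter_upwards [Filter.eventually_gt_atTop 1] with x hx
      rw [indicator_of_notMem (by simp [hx])]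
      simp) (by linarith)
    (by
      refine Asymptotics.IsBigO.of_bound 1 (Filter.Eventually.of_forall fun x => ?_)
      simp only [neg_zero, Real.rpow_zero, norm_one, mul_one]
      exact (norm_indicator_le_norm_self _ _).trans (by simp)) hs
  have hcongr : ∀ x ∈ Ioi (0 : ℝ), (x : ℂ) ^ (s - 1) • (Real.posLog x⁻¹ : ℂ) =
      -((x : ℂ) ^ (s - 1) • (Real.log x • indicator (Ioc 0 1) (fun _ => 1 : ℝ → ℂ) x)) := by
    intro x (hx : 0 < x)
    by_cases h1 : x ≤ 1
    · rw [indicator_of_mem (show x ∈ Ioc (0 : ℝ) 1 from ⟨hx, h1⟩), Real.posLog_eq_log (by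
        rw [abs_of_pos (inv_pos.2 hx)]; exact (one_le_inv₀ hx).2 h1), Real.log_inv]
      simp
    · rw [indicator_of_notMem (by simp [h1]), (Real.posLog_eq_zero_iff _).2 (by
        rw [abs_of_pos (inv_pos.2 hx)]; exact inv_le_one_of_one_le₀ (not_le.1 h1).le)]
      simp
  constructor
  · rw [MellinConvergent, integrableOn_congr_fun hcongr measurableSet_Ioi]
    exact hD.1.neg
  · rw [mellin, setIntegral_congr_fun measurableSet_Ioi hcongr, integral_neg]
    have h2 : HasDerivAt (mellin (indicator (Ioc 0 1) (fun _ => 1 : ℝ → ℂ))) (-(s ^ 2)⁻¹) s := by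
      have hs0 : s ≠ 0 := fun h => by simp [h] at hs
      refine (hasDerivAt_inv hs0).congr_of_eventuallyEq ?_
      filter_upwards [(isOpen_lt continuous_const Complex.continuous_re).mem_nhds hs] with w hw
      rw [(hasMellin_one_Ioc hw).2, one_div]
    have h3 := hD.2.unique h2
    rw [mellin] at h3
    rw [h3, neg_neg, one_div]

theorem integrable_inv_sq_vertical {c : ℝ} (hc : 0 < c) :
    Integrable (fun t : ℝ => 1 / ((c : ℂ) + t * Complex.I) ^ 2) := by
  have hne : ∀ t : ℝ, (c : ℂ) + t * Complex.I ≠ 0 := fun t h => by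
    have := congrArg Complex.re h
    simp at this
    exact hc.ne' this
  refine Integrable.mono' ((integrable_inv_one_add_sq.comp_div hc.ne').const_mul (c ^ 2)⁻¹)
    (Continuous.aestronglyMeasurable (Continuous.div (by fun_prop) (by fun_prop)
      fun t => pow_ne_zero _ (hne t))) (ae_of_all _ fun t => le_of_eq ?_)
  rw [norm_div, norm_pow, norm_one, ← Complex.normSq_eq_norm_sq, Complex.normSq_add_mul_I]
  field_simp

/-- `log⁺ y` as an inverse Mellin transform, along any line to the right of `0`. -/
theorem integral_cpow_div_sq {c y : ℝ} (hc : 0 < c) (hy : 0 < y) :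
    1 / (2 * (Real.pi : ℂ)) * ∫ t : ℝ, 1 / ((c : ℂ) + t * Complex.I) ^ 2 *
      (y : ℂ) ^ ((c : ℂ) + t * Complex.I) = (Real.posLog y : ℂ) := by
  have hre : ∀ t : ℝ, 0 < ((c : ℂ) + t * Complex.I).re := fun t => by simpa using hc
  have h := mellinInv_mellin_eq c (fun x : ℝ => (Real.posLog x⁻¹ : ℂ)) (inv_pos.2 hy)
    (hasMellin_posLog_inv (by simpa using hc)).1
    (by
      refine (integrable_inv_sq_vertical hc).congr (ae_of_all _ fun t => ?_)
      exact (hasMellin_posLog_inv (hre t)).2.symm)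
    (Complex.continuous_ofReal.continuousAt.comp
      (Real.continuous_posLog.continuousAt.comp (continuousAt_inv₀ (inv_pos.2 hy).ne')))
  rw [inv_inv] at h
  rw [← h, mellinInv, Complex.real_smul]
  push_cast
  congr 1
  refine integral_congr_ae (ae_of_all _ fun t => ?_)
  simp only
  rw [(hasMellin_posLog_inv (hre t)).2, smul_eq_mul, mul_comm,
    Complex.inv_cpow _ _ (by rw [Complex.arg_ofReal_of_nonneg hy.le]; exact Real.pi_pos.ne),
    Complex.cpow_neg, inv_inv]

section

variable {Ω : Type*} [MeasurableSpace Ω] {Q : Measure Ω} {Y : Ω → ℝ}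

/-- The Mellin-Barnes integral of the moments of `exp (-Y)`, by Fubini. Absolute convergence needs
only the factor `1 / s ^ 2`, since the moments are bounded on vertical lines. -/
theorem integral_complexMGF_neg_div_sq [SFinite Q] (hY : AEMeasurable Y Q) {c u : ℝ} (hc : 0 < c)
    (hcY : -c ∈ integrableExpSet Y Q) :
    Integrable (fun t : ℝ => 1 / ((c : ℂ) + t * Complex.I) ^ 2 *
      (complexMGF Y Q (-((c : ℂ) + t * Complex.I)) *
        Complex.exp (((c : ℂ) + t * Complex.I) * u))) ∧
    1 / (2 * (Real.pi : ℂ)) * ∫ t : ℝ, 1 / ((c : ℂ) + t * Complex.I) ^ 2 *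
      (complexMGF Y Q (-((c : ℂ) + t * Complex.I)) *
        Complex.exp (((c : ℂ) + t * Complex.I) * u)) =
      ((∫ ω, max (u - Y ω) 0 ∂Q : ℝ) : ℂ) := by
  have hpt : ∀ t : ℝ, 1 / ((c : ℂ) + t * Complex.I) ^ 2 *
      (complexMGF Y Q (-((c : ℂ) + t * Complex.I)) *
        Complex.exp (((c : ℂ) + t * Complex.I) * u)) =
      ∫ ω, 1 / ((c : ℂ) + t * Complex.I) ^ 2 *
        Complex.exp (((c : ℂ) + t * Complex.I) * ((u - Y ω : ℝ) : ℂ)) ∂Q := by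
    intro t
    rw [complexMGF, ← integral_mul_const, ← integral_const_mul]
    refine integral_congr_ae (ae_of_all _ fun ω => ?_)
    simp only
    rw [← Complex.exp_add]
    push_cast
    ring_nf
  have hint : Integrable (Function.uncurry fun (t : ℝ) (ω : Ω) =>
      1 / ((c : ℂ) + t * Complex.I) ^ 2 *
        Complex.exp (((c : ℂ) + t * Complex.I) * ((u - Y ω : ℝ) : ℂ)))
      ((volume : Measure ℝ).prod Q) := by
    refine Integrable.mono' ((integrable_inv_sq_vertical hc).norm.mul_prod
      (Integrable.const_mul hcY (Real.exp (c * u)))) ?_ (ae_of_all _ fun p => le_of_eq ?_)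
    · have h1 : AEMeasurable (fun p : ℝ × Ω => Y p.2) ((volume : Measure ℝ).prod Q) :=
        hY.comp_quasiMeasurePreserving Measure.quasiMeasurePreserving_snd
      refine AEMeasurable.aestronglyMeasurable ?_
      simp only [Function.uncurry_def]
      fun_prop
    · simp only [Function.uncurry, norm_mul, Complex.norm_exp]
      rw [← Real.exp_add]
      congr 2
      simp
      ring
  simp_rw [hpt]
  refine ⟨hint.integral_prod_left, ?_⟩
  rw [integral_integral_swap hint, ← integral_const_mul, ← integral_complex_ofReal]
  refine integral_congr_ae (ae_of_all _ fun ω => ?_)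
  have h := integral_cpow_div_sq hc (Real.exp_pos (u - Y ω))
  rw [Real.posLog, Real.log_exp, max_comm] at h
  simp only
  rw [← h]
  congr 1
  refine integral_congr_ae (ae_of_all _ fun t => ?_)
  simp only
  rw [Complex.cpow_def_of_ne_zero (by exact_mod_cast (Real.exp_pos _).ne'),
    ← Complex.ofReal_log (Real.exp_pos _).le, Real.log_exp, mul_comm ((u - Y ω : ℝ) : ℂ)]

end

/-! ### Waterfilling -/

section Waterfilling

variable {Ω : Type*} [MeasurableSpace Ω] {Q : Measure Ω} {g : Ω → ℝ}

theorem integrable_max_sub_inv [IsFiniteMeasure Q] (hg : AEMeasurable g Q)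
    (hpos : ∀ᵐ ω ∂Q, 0 < g ω) {v : ℝ} (hv : 0 ≤ v) :
    Integrable (fun ω => max (v - 1 / g ω) 0) Q := by
  refine Integrable.mono' (integrable_const v)
    (AEMeasurable.aestronglyMeasurable (by fun_prop)) ?_
  filter_upwards [hpos] with ω hω
  rw [Real.norm_of_nonneg (le_max_right _ _)]
  exact max_le (sub_le_self _ (by positivity)) hv

/-- The mean power is superlinear in the water level `v`, so it takes each positive value at
most once. -/
theorem integral_max_sub_inv_le [IsFiniteMeasure Q] (hg : AEMeasurable g Q)
    (hpos : ∀ᵐ ω ∂Q, 0 < g ω) {v w : ℝ} (hv : 0 < v) (hvw : v ≤ w) :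
    ∫ ω, max (v - 1 / g ω) 0 ∂Q ≤ v / w * ∫ ω, max (w - 1 / g ω) 0 ∂Q := by
  have hw := hv.trans_le hvw
  rw [← integral_const_mul]
  refine integral_mono_ae (integrable_max_sub_inv hg hpos hv.le)
    ((integrable_max_sub_inv hg hpos hw.le).const_mul _) ?_
  filter_upwards [hpos] with ω hω
  have h1 : v / w ≤ 1 := (div_le_one hw).2 hvw
  refine max_le ?_ (by positivity)
  calc v - 1 / g ω ≤ v - v / w * (1 / g ω) := by
        have : 0 < 1 / g ω := by positivity
        nlinarith
    _ = v / w * (w - 1 / g ω) := by field_simp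
    _ ≤ _ := by gcongr; exact le_max_left _ _

theorem continuousOn_integral_max_sub_inv [IsProbabilityMeasure Q] (hg : AEMeasurable g Q)
    (hpos : ∀ᵐ ω ∂Q, 0 < g ω) :
    ContinuousOn (fun v : ℝ => ∫ ω, max (v - 1 / g ω) 0 ∂Q) (Ici 0) := by
  refine (LipschitzOnWith.of_dist_le_mul (K := 1) fun v hv w hw => ?_).continuousOn
  rw [Real.dist_eq, ← integral_sub (integrable_max_sub_inv hg hpos hv)
    (integrable_max_sub_inv hg hpos hw), NNReal.coe_one, one_mul]
  have := norm_integral_le_of_norm_le_const (μ := Q) (C := dist v w)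
    (f := fun ω => max (v - 1 / g ω) 0 - max (w - 1 / g ω) 0) (ae_of_all _ fun ω => by
      have := abs_max_sub_max_le_abs (v - 1 / g ω) (w - 1 / g ω) 0
      rwa [sub_sub_sub_cancel_right] at this)
  simpa using this

/-- The mean power is unbounded in the water level. -/
theorem exists_le_integral_max_sub_inv [IsProbabilityMeasure Q] (hg : AEMeasurable g Q)
    (hpos : ∀ᵐ ω ∂Q, 0 < g ω) (S : ℝ) :
    ∃ v : ℝ, 0 ≤ v ∧ S ≤ ∫ ω, max (v - 1 / g ω) 0 ∂Q := by
  -- Truncation at a level above `S` lets dominated convergence apply as the water level grows.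
  have hlim : Filter.Tendsto (fun n : ℕ => ∫ ω, min (max (n - 1 / g ω) 0) (|S| + 1) ∂Q)
      Filter.atTop (nhds (∫ _, (|S| + 1) ∂Q)) := by
    refine tendsto_integral_of_dominated_convergence (fun _ => |S| + 1)
      (fun n => AEMeasurable.aestronglyMeasurable (by fun_prop)) (integrable_const _)
      (fun n => ae_of_all _ fun ω => ?_) (ae_of_all _ fun ω => ?_)
    · rw [Real.norm_of_nonneg (le_min (le_max_right _ _) (by positivity))]
      exact min_le_right _ _
    · refine tendsto_const_nhds.congr' ?_
      obtain ⟨m, hm⟩ := exists_nat_ge (1 / g ω + (|S| + 1))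
      filter_upwards [Filter.eventually_ge_atTop m] with n hn
      have : (m : ℝ) ≤ n := by exact_mod_cast hn
      exact (min_eq_right (le_max_of_le_left (by linarith))).symm
  have hS : S < ∫ _, (|S| + 1) ∂Q := by
    simp only [integral_const, probReal_univ, one_smul]
    linarith [le_abs_self S]
  obtain ⟨n, hn⟩ := (hlim.eventually (lt_mem_nhds hS)).exists
  refine ⟨n, by positivity, hn.le.trans ?_⟩
  have hi := integrable_max_sub_inv hg hpos (v := n) (by positivity)
  exact integral_mono (hi.inf (integrable_const _)) hi fun ω => min_le_left _ _

theorem existsUnique_isWaterfillingCutoff [IsProbabilityMeasure Q] (hg : AEMeasurable g Q)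
    (hpos : ∀ᵐ ω ∂Q, 0 < g ω) {S : ℝ} (hS : 0 < S) :
    ∃! μ : ℝ, IsWaterfillingCutoff Q g S μ := by
  have hzero : ∫ ω, max (0 - 1 / g ω) 0 ∂Q = 0 := by
    refine integral_eq_zero_of_ae ?_
    filter_upwards [hpos] with ω hω
    exact max_eq_right (by simpa using hω.le)
  obtain ⟨w, hw, hSw⟩ := exists_le_integral_max_sub_inv hg hpos S
  obtain ⟨v, hv, hvS⟩ := intermediate_value_Icc hw
    ((continuousOn_integral_max_sub_inv hg hpos).mono Icc_subset_Ici_self)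
    (show S ∈ Icc _ _ from ⟨by simpa only [hzero] using hS.le, hSw⟩)
  have hv0 : 0 < v := by
    refine hv.1.lt_of_ne ?_
    rintro rfl
    simp only [hzero] at hvS
    exact hS.ne hvS
  have hlt : ∀ μ₁ μ₂ : ℝ, IsWaterfillingCutoff Q g S μ₁ → IsWaterfillingCutoff Q g S μ₂ →
      μ₂ ≤ μ₁ := by
    rintro μ₁ μ₂ ⟨h1, e1⟩ ⟨h2, e2⟩
    by_contra! hlt
    have h3 := integral_max_sub_inv_le hg hpos (one_div_pos.2 h2)
      (one_div_le_one_div_of_le h1 hlt.le)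
    rw [e1, e2] at h3
    have h4 : 1 / μ₂ / (1 / μ₁) < 1 := by
      rw [div_lt_one (by positivity)]
      exact one_div_lt_one_div_of_lt h1 hlt
    nlinarith
  refine ⟨1 / v, ⟨by positivity, by simpa using hvS⟩, fun μ hμ => le_antisymm ?_ ?_⟩
  · exact hlt _ _ ⟨by positivity, by simpa using hvS⟩ hμ
  · exact hlt _ _ hμ ⟨by positivity, by simpa using hvS⟩

theorem one_add_mul_waterfilling_div {N μ x : ℝ} (hN : 0 < N) (hμ : 0 < μ) (hx : 0 < x) :
    1 + x * waterfilling N μ x / N = max (x / μ) 1 := by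
  rw [waterfilling, show 1 + x * (N * max (1 / μ - 1 / x) 0) / N
    = 1 + x * max (1 / μ - 1 / x) 0 by field_simp, mul_max_of_nonneg _ _ hx.le,
    ← max_add_add_left]
  congr 1
  · field_simp
    ring
  · ring

/-- Among all powers `p ≥ 0`, the waterfilling power maximizes the Lagrangian
`log (1 + x p / N) - μ p / N`. -/
theorem log_one_add_le_waterfilling {N μ x p : ℝ} (hN : 0 < N) (hμ : 0 < μ) (hx : 0 < x)
    (hp : 0 ≤ p) :
    Real.log (1 + x * p / N) ≤
      Real.log (1 + x * waterfilling N μ x / N) + μ / N * (p - waterfilling N μ x) := by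
  rw [one_add_mul_waterfilling_div hN hμ hx]
  have hm : 0 < max (x / μ) 1 := lt_max_of_lt_right one_pos
  have hq : 0 < 1 + x * p / N := by positivity
  have h1 : Real.log (1 + x * p / N) - Real.log (max (x / μ) 1)
      ≤ (1 + x * p / N) / max (x / μ) 1 - 1 := by
    rw [← Real.log_div hq.ne' hm.ne']
    exact Real.log_le_sub_one_of_pos (by positivity)
  suffices (1 + x * p / N) / max (x / μ) 1 - 1 ≤ μ / N * (p - waterfilling N μ x) by linarith
  rw [waterfilling]
  rcases le_total μ x with h | h
  · rw [max_eq_left ((one_le_div hμ).2 h),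
      max_eq_left (sub_nonneg.2 (one_div_le_one_div_of_le hμ h))]
    refine le_of_eq ?_
    field_simp
    ring
  · rw [max_eq_right ((div_le_one hμ).2 h),
      max_eq_right (sub_nonpos.2 (one_div_le_one_div_of_le hx h))]
    have : x * p / N ≤ μ * p / N := by gcongr
    calc _ = x * p / N := by ring
      _ ≤ _ := this
      _ = _ := by ring

variable {N Pavg μ : ℝ}

theorem isFeasiblePolicy_waterfilling [IsFiniteMeasure Q] (hg : AEMeasurable g Q)
    (hpos : ∀ᵐ ω ∂Q, 0 < g ω) (hN : 0 < N) (hμ : IsWaterfillingCutoff Q g (Pavg / N) μ) :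
    IsFeasiblePolicy Q g Pavg (waterfilling N μ) ∧ ∫ ω, waterfilling N μ (g ω) ∂Q = Pavg := by
  have heq : ∫ ω, waterfilling N μ (g ω) ∂Q = Pavg := by
    simp only [waterfilling]
    rw [integral_const_mul, hμ.2]
    field_simp
  refine ⟨⟨?_, fun x => mul_nonneg hN.le (le_max_right _ _), ?_, heq.le⟩, heq⟩
  · unfold waterfilling
    fun_prop
  · exact (integrable_max_sub_inv hg hpos (one_div_pos.2 hμ.1).le).const_mul N

theorem integrable_log_waterfilling
    (hint : Integrable (fun ω => Real.log (g ω)) Q) (hμi : Integrable (fun _ => Real.log μ) Q)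
    (hpos : ∀ᵐ ω ∂Q, 0 < g ω) (hN : 0 < N) (hμ : 0 < μ) :
    Integrable (fun ω => Real.log (1 + g ω * waterfilling N μ (g ω) / N)) Q := by
  refine ((hint.sub hμi).sup (integrable_zero Ω ℝ Q)).congr ?_
  filter_upwards [hpos] with ω hω
  change max (Real.log (g ω) - Real.log μ) 0 = _
  rw [one_add_mul_waterfilling_div hN hμ hω, ← Real.log_div hω.ne' hμ.ne',
    ← Real.log_one]
  exact ((Real.strictMonoOn_log.monotoneOn).map_max (show 0 < g ω / μ by positivity)
    (show (0 : ℝ) < 1 by norm_num)).symm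

/-- The pointwise Lagrangian bound also makes every feasible scheme's rate finite. -/
theorem integrable_log_of_isFeasiblePolicy [IsFiniteMeasure Q] (hg : AEMeasurable g Q)
    (hint : Integrable (fun ω => Real.log (g ω)) Q) (hpos : ∀ᵐ ω ∂Q, 0 < g ω) (hN : 0 < N)
    {P : ℝ → ℝ} (hP : IsFeasiblePolicy Q g Pavg P) :
    Integrable (fun ω => Real.log (1 + g ω * P (g ω) / N)) Q := by
  obtain ⟨hPm, hP0, hPi, -⟩ := hP
  -- The Lagrangian bound holds for every cutoff; the cutoff `1` is as good as any here.
  have hW : Integrable (fun ω => waterfilling N 1 (g ω)) Q :=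
    (integrable_max_sub_inv hg hpos (by norm_num)).const_mul N
  refine Integrable.mono' ((integrable_log_waterfilling hint (integrable_const _) hpos hN
    one_pos).add ((hPi.sub hW).const_mul (1 / N)))
    (AEMeasurable.aestronglyMeasurable ?_) ?_
  · have := hPm.comp_aemeasurable hg
    simp only [Function.comp_def] at this
    fun_prop
  · filter_upwards [hpos] with ω hω
    rw [Real.norm_of_nonneg]
    · exact log_one_add_le_waterfilling hN one_pos hω (hP0 _)
    · refine Real.log_nonneg (le_add_of_nonneg_right ?_)
      have := hP0 (g ω)
      positivity

/-- Weak duality: integrating the pointwise Lagrangian bound, no feasible scheme has a larger rate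
than waterfilling. -/
theorem averageRate_le_waterfilling [IsFiniteMeasure Q] (hg : AEMeasurable g Q)
    (hint : Integrable (fun ω => Real.log (g ω)) Q) (hpos : ∀ᵐ ω ∂Q, 0 < g ω) (hN : 0 < N)
    (hμ : IsWaterfillingCutoff Q g (Pavg / N) μ) (k : ℕ) {P : ℝ → ℝ}
    (hP : IsFeasiblePolicy Q g Pavg P) :
    averageRate Q g k N P ≤ averageRate Q g k N (waterfilling N μ) := by
  obtain ⟨hWf, hWe⟩ := isFeasiblePolicy_waterfilling hg hpos hN hμ
  have hWi := integrable_log_of_isFeasiblePolicy hg hint hpos hN hWf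
  have hdi := (hP.2.2.1.sub hWf.2.2.1).const_mul (μ / N)
  unfold averageRate
  refine mul_le_mul_of_nonneg_left ?_ (by positivity)
  have h1 := integral_mono_ae (integrable_log_of_isFeasiblePolicy hg hint hpos hN hP)
    (hWi.add hdi) (by
      filter_upwards [hpos] with ω hω
      exact log_one_add_le_waterfilling hN hμ.1 hω (hP.2.1 _))
  refine h1.trans ?_
  rw [integral_add' hWi hdi, integral_const_mul, integral_sub' hP.2.2.1 hWf.2.2.1, hWe]
  have : μ / N * (∫ ω, P (g ω) ∂Q - Pavg) ≤ 0 :=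
    mul_nonpos_of_nonneg_of_nonpos (div_pos hμ.1 hN).le (sub_nonpos.2 hP.2.2.2)
  linarith

theorem isGreatest_averageRate_waterfilling [IsFiniteMeasure Q] (hg : AEMeasurable g Q)
    (hint : Integrable (fun ω => Real.log (g ω)) Q) (hpos : ∀ᵐ ω ∂Q, 0 < g ω) (hN : 0 < N)
    (hμ : IsWaterfillingCutoff Q g (Pavg / N) μ) (k : ℕ) :
    IsGreatest (achievableRates Q g k N Pavg) (averageRate Q g k N (waterfilling N μ)) := by
  refine ⟨⟨_, (isFeasiblePolicy_waterfilling hg hpos hN hμ).1, rfl⟩, ?_⟩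
  rintro _ ⟨P, hP, rfl⟩
  exact averageRate_le_waterfilling hg hint hpos hN hμ k hP

end Waterfilling

/-! ### The ergodic capacity -/

section Capacity

variable {Ω : Type*} [MeasurableSpace Ω] {Q : Measure Ω} {Ia Ip : Ω → ℝ} {a b A₀ ξ : ℝ}

theorem zero_mem_interior_integrableExpSet_log_gain (ha : 0 < a) (hb : 0 < b) (hA₀ : 0 < A₀)
    (hξ : 0 < ξ)
    (hIa : HasLaw Ia (gammaGammaLaw a b) Q) (hIp : HasLaw Ip (pointingErrorLaw A₀ ξ) Q)
    (hindep : IndepFun Ia Ip Q) :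
    0 ∈ interior (integrableExpSet (fun ω => Real.log (Ia ω * Ip ω)) Q) := by
  refine mem_interior.2 ⟨Ioi (-a) ∩ (Ioi (-b) ∩ Ioi (-ξ ^ 2)), fun t ht => ?_,
    isOpen_Ioi.inter (isOpen_Ioi.inter isOpen_Ioi), by simpa using ⟨ha, hb, pow_pos hξ 2⟩⟩
  exact mem_integrableExpSet_log_gain ha hb hA₀ hIa hIp hindep ht.1 ht.2.1 ht.2.2

/-- The mean of `log λ` is the derivative at `0` of the complex moments. -/
theorem integral_log_gain [IsProbabilityMeasure Q] (ha : 0 < a) (hb : 0 < b) (hA₀ : 0 < A₀)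
    (hξ : 0 < ξ)
    (hIa : HasLaw Ia (gammaGammaLaw a b) Q) (hIp : HasLaw Ip (pointingErrorLaw A₀ ξ) Q)
    (hindep : IndepFun Ia Ip Q) :
    ((∫ ω, Real.log (Ia ω * Ip ω) ∂Q : ℝ) : ℂ) =
      (Real.log (A₀ / (a * b)) : ℂ) + Complex.digamma a + Complex.digamma b - 1 / (ξ : ℂ) ^ 2 := by
  have h1 := hasDerivAt_complexMGF (z := 0)
    (zero_mem_interior_integrableExpSet_log_gain ha hb hA₀ hξ hIa hIp hindep)
  have hΓ : ∀ {c : ℝ}, 0 < c → HasDerivAt (fun z : ℂ => Complex.Gamma (c + z) / Real.Gamma c)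
      (Complex.digamma c) 0 := by
    intro c hc
    have hd : DifferentiableAt ℂ Complex.Gamma ((c : ℂ) + 0) := by
      refine Complex.differentiableAt_Gamma _ fun m h => ?_
      have := congrArg Complex.re h
      simp at this
      have : (0 : ℝ) ≤ m := m.cast_nonneg
      linarith
    have := (hd.hasDerivAt.comp_const_add (c : ℂ) (0 : ℂ)).div_const (Real.Gamma c : ℂ)
    rw [add_zero] at this
    rw [Complex.digamma_def, logDeriv_apply]
    simpa only [Complex.Gamma_ofReal] using this
  have hξ1 : (ξ : ℂ) ≠ 0 := by exact_mod_cast hξ.ne'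
  have hξ0 : (ξ : ℂ) ^ 2 ≠ 0 := pow_ne_zero _ hξ1
  have h2 : HasDerivAt (fun z : ℂ => Complex.exp (z * Real.log (A₀ / (a * b))) *
        (Complex.Gamma (a + z) / Real.Gamma a * (Complex.Gamma (b + z) / Real.Gamma b)) *
        ((ξ : ℂ) ^ 2 / ((ξ : ℂ) ^ 2 + z)))
      ((Real.log (A₀ / (a * b)) : ℂ) + Complex.digamma a + Complex.digamma b
        - 1 / (ξ : ℂ) ^ 2) 0 := by
    have hL := ((hasDerivAt_id (0 : ℂ)).mul_const (Real.log (A₀ / (a * b)) : ℂ)).cexp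
    have hP := (hasDerivAt_const (0 : ℂ) ((ξ : ℂ) ^ 2)).div
      ((hasDerivAt_id (0 : ℂ)).const_add ((ξ : ℂ) ^ 2)) (by simpa using hξ0)
    refine ((hL.mul ((hΓ ha).mul (hΓ hb))).mul hP).congr_deriv ?_
    have hga : (Real.Gamma a : ℂ) ≠ 0 := by exact_mod_cast (Real.Gamma_pos_of_pos ha).ne'
    have hgb : (Real.Gamma b : ℂ) ≠ 0 := by exact_mod_cast (Real.Gamma_pos_of_pos hb).ne'
    simp only [Pi.mul_apply, Pi.div_apply, id, add_zero, Complex.Gamma_ofReal, zero_mul,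
      Complex.exp_zero, div_self hga, div_self hgb, div_self hξ0, one_mul, mul_one]
    field_simp
    ring
  have h3 := (h1.congr_of_eventuallyEq (f₁ := fun z : ℂ =>
    Complex.exp (z * Real.log (A₀ / (a * b))) *
        (Complex.Gamma (a + z) / Real.Gamma a * (Complex.Gamma (b + z) / Real.Gamma b)) *
        ((ξ : ℂ) ^ 2 / ((ξ : ℂ) ^ 2 + z))) (by
      have hn : ∀ {r : ℝ}, 0 < r → ∀ᶠ z : ℂ in nhds 0, -r < z.re := fun hr =>
        (isOpen_lt continuous_const Complex.continuous_re).mem_nhds (by simpa using hr)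
      filter_upwards [hn ha, hn hb, hn (pow_pos hξ 2)] with z h1 h2 h3
      exact (complexMGF_log_gain ha hb hA₀ hIa hIp hindep h1 h2 h3).symm)).unique h2
  rw [← h3, ← integral_complex_ofReal]
  simp

variable {c μ : ℝ}

theorem meijerSeparates_iff (a b ξ c : ℝ) :
    MeijerSeparates 3 2 ![1, 1, (ξ : ℂ) ^ 2 + 1] ![(ξ : ℂ) ^ 2, (a : ℂ), (b : ℂ), 0, 0] c ↔
      (c < ξ ^ 2 ∧ c < a ∧ c < b) ∧ 0 < c := by
  simp [MeijerSeparates, Fin.forall_fin_succ, re_ofReal_sq]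

/-- Up to constants, the Mellin-Barnes integrand is `1 / s ^ 2` times the moment `E[(μ / λ) ^ s]`:
`Γ(s) / Γ(1 + s) = 1 / s` and `Γ(ξ² - s) / Γ(ξ² + 1 - s) = 1 / (ξ² - s)`. -/
theorem meijerIntegrand_eq (ha : 0 < a) (hb : 0 < b) (hA₀ : 0 < A₀) (hξ : 0 < ξ) (hμ : 0 < μ)
    (hIa : HasLaw Ia (gammaGammaLaw a b) Q) (hIp : HasLaw Ip (pointingErrorLaw A₀ ξ) Q)
    (hindep : IndepFun Ia Ip Q) (hc : 0 < c) (hca : c < a) (hcb : c < b) (hcξ : c < ξ ^ 2)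
    (t : ℝ) :
    meijerIntegrand 3 2 ![1, 1, (ξ : ℂ) ^ 2 + 1] ![(ξ : ℂ) ^ 2, (a : ℂ), (b : ℂ), 0, 0]
        ((a * b / A₀ * μ : ℝ) : ℂ) c t =
      (Real.Gamma a * Real.Gamma b / (ξ : ℂ) ^ 2) * (1 / ((c : ℂ) + t * Complex.I) ^ 2 *
      (complexMGF (fun ω => Real.log (Ia ω * Ip ω)) Q (-((c : ℂ) + t * Complex.I)) *
        Complex.exp (((c : ℂ) + t * Complex.I) * Real.log μ))) := by
  set s : ℂ := (c : ℂ) + t * Complex.I with hs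
  have hsre : s.re = c := by simp [hs]
  have hs0 : s ≠ 0 := fun h => by simp [h] at hsre; exact hc.ne hsre
  have hξs : (ξ : ℂ) ^ 2 - s ≠ 0 := fun h => by
    have := congrArg Complex.re h
    rw [Complex.sub_re, re_ofReal_sq, hsre, Complex.zero_re] at this
    linarith
  have hξ1 : (ξ : ℂ) ≠ 0 := by exact_mod_cast hξ.ne'
  have hξ0 : (ξ : ℂ) ^ 2 ≠ 0 := pow_ne_zero _ hξ1
  have hga : (Real.Gamma a : ℂ) ≠ 0 := by exact_mod_cast (Real.Gamma_pos_of_pos ha).ne'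
  have hgb : (Real.Gamma b : ℂ) ≠ 0 := by exact_mod_cast (Real.Gamma_pos_of_pos hb).ne'
  have hΓs : Complex.Gamma s ≠ 0 := Complex.Gamma_ne_zero_of_re_pos (by rw [hsre]; exact hc)
  have hΓξ : Complex.Gamma ((ξ : ℂ) ^ 2 - s) ≠ 0 := Complex.Gamma_ne_zero_of_re_pos (by
    rw [Complex.sub_re, re_ofReal_sq, hsre]; linarith)
  have hker : meijerKernel 3 2 ![1, 1, (ξ : ℂ) ^ 2 + 1]
      ![(ξ : ℂ) ^ 2, (a : ℂ), (b : ℂ), 0, 0] s =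
      Complex.Gamma (a - s) * Complex.Gamma (b - s) / (s ^ 2 * ((ξ : ℂ) ^ 2 - s)) := by
    have h1 : Complex.Gamma (1 + s) = s * Complex.Gamma s := by
      rw [add_comm, Complex.Gamma_add_one _ hs0]
    have h2 : Complex.Gamma ((ξ : ℂ) ^ 2 + 1 - s) =
        ((ξ : ℂ) ^ 2 - s) * Complex.Gamma ((ξ : ℂ) ^ 2 - s) := by
      rw [← Complex.Gamma_add_one _ hξs]
      ring_nf
    simp [meijerKernel, Fin.prod_univ_succ, h1, h2]
    field_simp
  have hpow : ((a * b / A₀ * μ : ℝ) : ℂ) ^ s =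
      Complex.exp (-s * Real.log (A₀ / (a * b))) * Complex.exp (s * Real.log μ) := by
    rw [← cexp_mul_log (by positivity), ← Complex.exp_add,
      Real.log_mul (by positivity) hμ.ne', ← inv_div A₀, Real.log_inv]
    push_cast
    ring_nf
  rw [meijerIntegrand, ← hs, hker, hpow, complexMGF_log_gain ha hb hA₀ hIa hIp hindep
    (by rw [Complex.neg_re, hsre]; linarith) (by rw [Complex.neg_re, hsre]; linarith)
    (by rw [Complex.neg_re, hsre]; linarith)]
  simp only [← sub_eq_add_neg]
  field_simp

/-- The Meijer function of the capacity formula is, up to constants, `E[log⁺ (μ / λ)]`. -/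
theorem hasMeijerG_gain [IsProbabilityMeasure Q] (ha : 0 < a) (hb : 0 < b) (hA₀ : 0 < A₀)
    (hξ : 0 < ξ) (hμ : 0 < μ)
    (hIa : HasLaw Ia (gammaGammaLaw a b) Q) (hIp : HasLaw Ip (pointingErrorLaw A₀ ξ) Q)
    (hindep : IndepFun Ia Ip Q) :
    HasMeijerG 3 2 ![1, 1, (ξ : ℂ) ^ 2 + 1] ![(ξ : ℂ) ^ 2, (a : ℂ), (b : ℂ), 0, 0]
      ((a * b / A₀ * μ : ℝ) : ℂ)
      ((Real.Gamma a * Real.Gamma b / (ξ : ℂ) ^ 2) *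
        ((∫ ω, max (Real.log μ - Real.log (Ia ω * Ip ω)) 0 ∂Q : ℝ) : ℂ)) := by
  refine ⟨?_, fun c hc => ?_⟩
  · have hm : 0 < min (ξ ^ 2) (min a b) := lt_min (by positivity) (lt_min ha hb)
    obtain ⟨c, hc0, hc⟩ := exists_between hm
    rw [lt_min_iff, lt_min_iff] at hc
    exact ⟨c, (meijerSeparates_iff a b ξ c).2 ⟨hc, hc0⟩⟩
  · obtain ⟨⟨hcξ, hca, hcb⟩, hc0⟩ := (meijerSeparates_iff a b ξ c).1 hc
    obtain ⟨hi, he⟩ := integral_complexMGF_neg_div_sq (Q := Q)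
      (Y := fun ω => Real.log (Ia ω * Ip ω)) (u := Real.log μ)
      (hIa.aemeasurable.mul hIp.aemeasurable).log hc0
      (mem_integrableExpSet_log_gain ha hb hA₀ hIa hIp hindep (neg_lt_neg hca) (neg_lt_neg hcb)
        (neg_lt_neg hcξ))
    have heq : (fun t : ℝ => meijerIntegrand 3 2 ![1, 1, (ξ : ℂ) ^ 2 + 1]
        ![(ξ : ℂ) ^ 2, (a : ℂ), (b : ℂ), 0, 0] ((a * b / A₀ * μ : ℝ) : ℂ) c t) = _ :=
      funext fun t => meijerIntegrand_eq ha hb hA₀ hξ hμ hIa hIp hindep hc0 hca hcb hcξ t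
    rw [heq]
    refine ⟨hi.const_mul _, ?_⟩
    rw [integral_const_mul, ← he]
    ring

theorem HasMeijerG.unique {m n p q : ℕ} {α : Fin p → ℂ} {β : Fin q → ℂ} {z w w' : ℂ}
    (h : HasMeijerG m n α β z w) (h' : HasMeijerG m n α β z w') : w = w' := by
  obtain ⟨c, hc⟩ := h.1
  rw [← (h.2 c hc).2, (h'.2 c hc).2]

theorem HasMeijerG.meijerG_eq {m n p q : ℕ} {α : Fin p → ℂ} {β : Fin q → ℂ} {z w : ℂ}
    (h : HasMeijerG m n α β z w) : meijerG m n α β z = w := by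
  have hex : ∃ w, HasMeijerG m n α β z w := ⟨w, h⟩
  rw [meijerG, dif_pos hex]
  exact hex.choose_spec.unique h

/-- The waterfilling rate, through `log⁺ (λ / μ) = log λ - log μ + log⁺ (μ / λ)`. -/
theorem integral_log_waterfilling [IsProbabilityMeasure Q] {g : Ω → ℝ} {N : ℝ}
    (hint : Integrable (fun ω => Real.log (g ω)) Q) (hpos : ∀ᵐ ω ∂Q, 0 < g ω) (hN : 0 < N)
    (hμ : 0 < μ) :
    ∫ ω, Real.log (1 + g ω * waterfilling N μ (g ω) / N) ∂Q =
      ∫ ω, Real.log (g ω) ∂Q - Real.log μ + ∫ ω, max (Real.log μ - Real.log (g ω)) 0 ∂Q := by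
  have hd : Integrable (fun ω => Real.log (g ω) - Real.log μ) Q := hint.sub (integrable_const _)
  have hm : Integrable (fun ω => max (Real.log μ - Real.log (g ω)) 0) Q :=
    ((integrable_const _).sub hint).sup (integrable_zero Ω ℝ Q)
  have h0 : ∫ ω, Real.log (g ω) ∂Q - Real.log μ = ∫ ω, (Real.log (g ω) - Real.log μ) ∂Q := by
    rw [integral_sub hint (integrable_const _)]
    simp
  rw [h0, ← integral_add hd hm]
  refine integral_congr_ae ?_
  filter_upwards [hpos] with ω hω
  rw [one_add_mul_waterfilling_div hN hμ hω]
  rcases le_total μ (g ω) with h | h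
  · have h2 := Real.log_le_log hμ h
    rw [max_eq_left ((one_le_div hμ).2 h), Real.log_div hω.ne' hμ.ne', max_eq_right (by linarith)]
    ring
  · have h2 := Real.log_le_log hω h
    rw [max_eq_right ((div_le_one hμ).2 h), Real.log_one, max_eq_left (by linarith)]
    ring

end Capacity

theorem theorem1 {Ω : Type*} [MeasurableSpace Ω] (Q : Measure Ω) [IsProbabilityMeasure Q]
    (Ia Ip gain : Ω → ℝ) (a b A₀ ξ N Pavg : ℝ) (k : ℕ)
    (ha : 0 < a) (hb : 0 < b) (hA₀ : 0 < A₀) (hξ : 0 < ξ) (hN : 0 < N) (hPavg : 0 < Pavg)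
    (hk : k = 1 ∨ k = 2)
    (hIa : HasLaw Ia (gammaGammaLaw a b) Q) (hIp : HasLaw Ip (pointingErrorLaw A₀ ξ) Q)
    (hindep : IndepFun Ia Ip Q) (hgain : ∀ ω, gain ω = Ia ω * Ip ω) :
    (∃! μ : ℝ, IsWaterfillingCutoff Q gain (Pavg / N) μ) ∧
    (∀ P : ℝ → ℝ, IsFeasiblePolicy Q gain Pavg P →
      Integrable (fun ω => Real.log (1 + gain ω * P (gain ω) / N)) Q) ∧
    ∀ μ : ℝ, IsWaterfillingCutoff Q gain (Pavg / N) μ →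
      IsGreatest (achievableRates Q gain k N Pavg) (ergodicCapacity Q gain k N Pavg) ∧
      IsFeasiblePolicy Q gain Pavg (waterfilling N μ) ∧
      averageRate Q gain k N (waterfilling N μ) = ergodicCapacity Q gain k N Pavg ∧
      HasMeijerG 3 2 ![1, 1, (ξ : ℂ) ^ 2 + 1] ![(ξ : ℂ) ^ 2, (a : ℂ), (b : ℂ), 0, 0]
        ((a * b / A₀ * μ : ℝ) : ℂ)
        (meijerG 3 2 ![1, 1, (ξ : ℂ) ^ 2 + 1] ![(ξ : ℂ) ^ 2, (a : ℂ), (b : ℂ), 0, 0]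
          ((a * b / A₀ * μ : ℝ) : ℂ)) ∧
      (ergodicCapacity Q gain k N Pavg : ℂ) =
        1 / (k : ℂ) *
          ((Real.log (A₀ / (a * b)) : ℂ) + Complex.digamma a + Complex.digamma b
            - 1 / (ξ : ℂ) ^ 2 - (Real.log μ : ℂ)
            + (ξ : ℂ) ^ 2 / ((Real.Gamma a : ℂ) * (Real.Gamma b : ℂ)) *
              meijerG 3 2 ![1, 1, (ξ : ℂ) ^ 2 + 1] ![(ξ : ℂ) ^ 2, (a : ℂ), (b : ℂ), 0, 0]
                ((a * b / A₀ * μ : ℝ) : ℂ)) := by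
  have hfun : gain = fun ω => Ia ω * Ip ω := funext hgain
  subst hfun
  clear hgain
  have hg : AEMeasurable (fun ω => Ia ω * Ip ω) Q := hIa.aemeasurable.mul hIp.aemeasurable
  have hpos : ∀ᵐ ω ∂Q, 0 < Ia ω * Ip ω := by
    filter_upwards [(ae_pos_gain hIa hIp).1, (ae_pos_gain hIa hIp).2] with ω h1 h2
    exact mul_pos h1 h2
  have hint : Integrable (fun ω => Real.log (Ia ω * Ip ω)) Q := by
    -- `log` of the gain has exponential moments on both sides of `0`.
    have h := integrable_pow_mul_exp_of_mem_interior_integrableExpSet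
      (zero_mem_interior_integrableExpSet_log_gain ha hb hA₀ hξ hIa hIp hindep) 1
    simpa using h
  refine ⟨existsUnique_isWaterfillingCutoff hg hpos (div_pos hPavg hN),
    fun P hP => integrable_log_of_isFeasiblePolicy hg hint hpos hN hP, fun μ hμ => ?_⟩
  have hgr := isGreatest_averageRate_waterfilling hg hint hpos hN hμ k
  have hC : ergodicCapacity Q (fun ω => Ia ω * Ip ω) k N Pavg =
      averageRate Q (fun ω => Ia ω * Ip ω) k N (waterfilling N μ) := hgr.csSup_eq
  have hG := hasMeijerG_gain ha hb hA₀ hξ hμ.1 hIa hIp hindep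
  refine ⟨hC ▸ hgr, (isFeasiblePolicy_waterfilling hg hpos hN hμ).1, hC.symm, ?_, ?_⟩
  · rw [hG.meijerG_eq]
    exact hG
  · have hξ0 : (ξ : ℂ) ≠ 0 := by exact_mod_cast hξ.ne'
    have hga : (Real.Gamma a : ℂ) ≠ 0 := by exact_mod_cast (Real.Gamma_pos_of_pos ha).ne'
    have hgb : (Real.Gamma b : ℂ) ≠ 0 := by exact_mod_cast (Real.Gamma_pos_of_pos hb).ne'
    rw [hC, averageRate, integral_log_waterfilling hint hpos hN hμ.1, hG.meijerG_eq,
      ← integral_log_gain ha hb hA₀ hξ hIa hIp hindep]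
    push_cast
    field_simp
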